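/- Let $t\ge 2$ and $n\ge 1$ be integers and $A=\{0,1,\dots,t-1\}$. A de Bruijn sequence of order $n$ over $A$ is a finite sequence of symbols of $A$ in which every word of length $n$ over $A$ occurs exactly once as a block of contiguous symbols; only de Bruijn sequences that start with the word $0^n$ are considered. A preference function of span $s$ is a map $P=(P_1,\dots,P_t)$ on $A^s$ such that for each $\mathbf a\in A^s$ the entries $P_1(\mathbf a),\dots,P_t(\mathbf a)$ form a permutation of $A$. For $s\le n$, it generates from $0^n$ the following finite sequence: start with $n$ zeros; if the sequence built so far ends in the word $\mathbf a$ of length $s$, append $P_i(\mathbf a)$, where $i$ is the smallest index such that the word of length $n$ formed by the last $n-1$ symbols followed by $P_i(\mathbf a)$ has not previously appeared as a segment of the sequence; stop when there is no such $i$. The preference function complexity $\mathrm{comp}(S)$ of a de Bruijn sequence $S$ of order $n$ starting with $0^n$ is the smallest integer $s$, $0\le s\le n$, such that some preference function of span $s$ generates $S$ from $0^n$. **Proposition.** Every de Bruijn sequence $S$ of order $n$ starting with $0^n$ satisfies $0\le\mathrm{comp}(S)\le n-1$. For $0\le i\le n-1$ let $N_i(n)$ be the number of those $S$ with $\mathrm{comp}(S)=i$.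 Then $$N_0(n)=(t-1)!,$$ $$N_1(n)=((t-1)!)^t\,t^{\,t-2}-(t-1)!\qquad(\text{if } n\ge 2),$$ $$N_i(n)=((t-1)!)^{t^i}\,t^{\,t^i-i-1}-((t-1)!)^{t^{i-1}}\,t^{\,t^{i-1}-i}\qquad(1<i\le n-1).$$ In particular, $N_i(n)$ does not depend on $n$ for $n>i$. -/

import Mathlib

/-- A preference function of span `s` over the alphabet `{0, …, t-1}`: to every word `a` of length
`s` it assigns a permutation of the alphabet, listed as `P a 0, P a 1, …, P a (t-1)` from the most
preferred digit to the least preferred one. -/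
abbrev PreferenceFunction (t s : ℕ) : Type := (Fin s → Fin t) → Equiv.Perm (Fin t)

/-- `S` is a (linearly written) de Bruijn sequence of order `n`: every word of length `n` occurs
at exactly one position of `S` as a block of contiguous symbols. -/
def IsDeBruijn {t : ℕ} (n : ℕ) (S : List (Fin t)) : Prop :=
  ∀ w : List (Fin t), w.length = n → ∃! k : ℕ, k + n ≤ S.length ∧ (S.drop k).take n = w

/-- The word formed by the last `s` symbols of `L`
(only used when `s ≤ L.length`, so that the default value of `getD` plays no role). -/
def lastWord {t : ℕ} [NeZero t] (s : ℕ) (L : List (Fin t)) : Fin s → Fin t :=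
  fun k => L.getD (L.length - s + k) 0

/-- The word of length `n` formed by the last `n - 1` symbols of `L` and the proposed symbol `x`
has not appeared as a segment of `L`. -/
def IsNew {t : ℕ} (n : ℕ) (L : List (Fin t)) (x : Fin t) : Prop :=
  ¬ (L.rtake (n - 1) ++ [x]) <:+: L

/-- `S` is the finite sequence of order `n` that the preference function `P` of span `s ≤ n`
produces from the initial word `0ⁿ`: at each step the most preferred digit (given the last `s`
symbols) which creates a new word of length `n` is appended, and the sequence stops as soon as no
digit creates a new word. -/
structure IsGeneratedBy {t : ℕ} [NeZero t] (n : ℕ) {s : ℕ} (P : PreferenceFunction t s)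
    (S : List (Fin t)) : Prop where
  initial : List.replicate n (0 : Fin t) <+: S
  next : ∀ (L : List (Fin t)) (x : Fin t), n ≤ L.length → (L ++ [x]) <+: S →
    ∃ i : Fin t, x = P (lastWord s L) i ∧ IsNew n L (P (lastWord s L) i) ∧
      ∀ j : Fin t, j < i → ¬ IsNew n L (P (lastWord s L) j)
  halts : ∀ i : Fin t, ¬ IsNew n S (P (lastWord s S) i)

/-- `S` is a de Bruijn sequence of order `n` that starts with the word `0ⁿ`. -/
def IsZeroDeBruijn {t : ℕ} [NeZero t] (n : ℕ) (S : List (Fin t)) : Prop :=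
  IsDeBruijn n S ∧ List.replicate n (0 : Fin t) <+: S

/-- The preference function complexity of `S` (as a sequence of order `n`) is `c`: the smallest
`s` with `0 ≤ s ≤ n` such that some preference function of span `s` generates `S` from `0ⁿ`. -/
def HasPrefComplexity {t : ℕ} [NeZero t] (n : ℕ) (S : List (Fin t)) (c : ℕ) : Prop :=
  IsLeast {s : ℕ | s ≤ n ∧ ∃ P : PreferenceFunction t s, IsGeneratedBy n P S} c

/-- The number `N_i(n)` of de Bruijn sequences of order `n` over `{0, …, t-1}` that start with `0ⁿ`
and have preference function complexity `i`. -/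
noncomputable def prefComplexityCount (t : ℕ) [NeZero t] (n i : ℕ) : ℕ :=
  {S : List (Fin t) | IsZeroDeBruijn n S ∧ HasPrefComplexity n S i}.ncard

open Finset Matrix

/-! Put m = n - 1 and read a sequence as a walk in the de Bruijn graph on words of length m, each
word of length n being an edge. For a preference function P of span s ≤ m let g(u) be the least
preferred letter after u. Everything rests on the condition `LeadsToZero` for g.

Sufficiency (`Follows.visitsOnce`): counting entries and exits shows that the walk halts at the zero
word with all its exits used, and that a word with all exits used has all entries used. The least
preferred exit from a nonzero word is used last, so exhaustion spreads backwards along the g-edges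
to every word.

Necessity (`Follows.exists_iterate`): in a de Bruijn sequence the last exit from a nonzero word is
its g-edge, so following g-edges moves forward in time until the zero word is reached. If s < m this
forces g(0) = 0; if s = m the preferences can be chosen so. With g(0) = 0, P is recovered from S as
the order in which letters follow each word (`preferenceFunction_eq_of_follows`).

Hence the sequences of span s correspond to the P with `LeadsToZero`. Each g arises from
((t-1)!)^(t^s) functions P, and the g are the spanning trees of the de Bruijn graph on words of
length s directed to zero, t^(t^s-s-1) in number by a determinant (`card_leadsToZero`). The
generated sets grow with s, so the counts by complexity are successive differences. -/

/-! ### Determinants of functional graphs -/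

/-- The adjacency matrix, restricted to rows other than that of `r`, of the functional graph
of `h`. -/
def functionalMatrix {α : Type*} [DecidableEq α] (h : α → α) (r : α) : Matrix α α ℤ :=
  fun v w => if v = r then 0 else if h v = w then 1 else 0

theorem functionalMatrix_mulVec {α : Type*} [Fintype α] [DecidableEq α] (h : α → α) (r : α)
    (f : α → ℤ) (v : α) :
    (functionalMatrix h r *ᵥ f) v = if v = r then 0 else f (h v) := by
  by_cases hv : v = r <;> simp [functionalMatrix, Matrix.mulVec, dotProduct, hv]

theorem functionalMatrix_pow_mulVec {α : Type*} [Fintype α] [DecidableEq α] (h : α → α) (r : α)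
    (f : α → ℤ) (k : ℕ) : ∀ (j : ℕ) (v : α), h^[j] v = r → j < k →
      (functionalMatrix h r ^ k *ᵥ f) v = 0 := by
  induction k with
  | zero => intro j v _ hj; omega
  | succ k ih =>
    intro j v hv hj
    rw [pow_succ', ← Matrix.mulVec_mulVec, functionalMatrix_mulVec]
    split_ifs with hr
    · rfl
    · cases j with
      | zero => exact absurd hv hr
      | succ j => exact ih j _ hv (by omega)

theorem functionalMatrix_isNilpotent {α : Type*} [Fintype α] [DecidableEq α] (h : α → α) (r : α)
    (hr : ∀ u, ∃ k, h^[k] u = r) : IsNilpotent (functionalMatrix h r) := by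
  choose k hk using hr
  refine ⟨(Finset.univ.sup k) + 1, ?_⟩
  apply Matrix.ext_of_mulVec_single
  intro i
  funext v
  rw [functionalMatrix_pow_mulVec h r _ _ (k v) v (hk v)
    (Nat.lt_succ_of_le (Finset.le_sup (Finset.mem_univ v)))]
  simp

/-- The characteristic polynomial differs from a power of X by a nilpotent element of the reduced
ring ℤ[X], hence equals it. -/
theorem Matrix.det_smul_one_sub_of_isNilpotent {α : Type*} [Fintype α] [DecidableEq α]
    {N : Matrix α α ℤ} (hN : IsNilpotent N) (c : ℤ) :
    (c • (1 : Matrix α α ℤ) - N).det = c ^ Fintype.card α := by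
  have h1 : N.charpoly = Polynomial.X ^ Fintype.card α := by
    have := (Matrix.isNilpotent_charpoly_sub_pow_of_isNilpotent hN).eq_zero
    exact sub_eq_zero.mp this
  have h2 := Matrix.eval_charpoly N c
  rw [h1, Polynomial.eval_pow, Polynomial.eval_X] at h2
  rw [h2, Matrix.scalar_apply, Matrix.smul_one_eq_diagonal]

open Classical in
theorem det_one_sub_functionalMatrix {α : Type*} [Fintype α] [DecidableEq α] (h : α → α) (r : α) :
    (1 - functionalMatrix h r).det = if ∀ u, ∃ k, h^[k] u = r then 1 else 0 := by
  split_ifs with hg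
  · simpa using Matrix.det_smul_one_sub_of_isNilpotent (functionalMatrix_isNilpotent h r hg) 1
  · by_contra hdet
    push Not at hg
    obtain ⟨u, hu⟩ := hg
    -- The indicator of the points that never reach `r` is constant along `h` and zero at `r`: a
    -- nonzero kernel vector.
    let f : α → ℤ := fun v => if ∃ k, h^[k] v = r then 0 else 1
    have hf : (1 - functionalMatrix h r) *ᵥ f = 0 := by
      funext v
      rw [Matrix.sub_mulVec, Matrix.one_mulVec, Pi.sub_apply, functionalMatrix_mulVec]
      by_cases hv : v = r
      · have : ∃ k, h^[k] v = r := ⟨0, hv⟩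
        rw [if_pos hv]
        simp only [f, if_pos this]
        rfl
      · rw [if_neg hv]
        have : (∃ k, h^[k] v = r) ↔ ∃ k, h^[k] (h v) = r := by
          constructor
          · rintro ⟨k, hk⟩
            cases k with
            | zero => exact absurd hk hv
            | succ k => exact ⟨k, hk⟩
          · rintro ⟨k, hk⟩
            exact ⟨k + 1, hk⟩
        simp only [f, this, sub_self]
        rfl
    have := Matrix.eq_zero_of_mulVec_eq_zero hdet hf
    have h2 := congrFun this u
    have h3 : ¬ ∃ k, h^[k] u = r := fun ⟨k, hk⟩ => hu k hk
    simp [f, h3] at h2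

/-! ### Spanning trees of the de Bruijn graph -/

/-- The word obtained from `v` by deleting its first letter and appending `x`. -/
def shiftWord {t s : ℕ} (v : Fin s → Fin t) (x : Fin t) : Fin s → Fin t :=
  Fin.tail (Fin.snoc v x : Fin (s + 1) → Fin t)

theorem shiftWord_apply {t s : ℕ} (v : Fin s → Fin t) (x : Fin t) (k : Fin s) :
    shiftWord v x k = if h : (k : ℕ) + 1 < s then v ⟨k + 1, h⟩ else x := by
  simp only [shiftWord, Fin.tail, Fin.snoc, Fin.val_succ]
  rfl

/-- Every word has exactly t entering edges, one for each deleted first letter. -/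
theorem sum_shiftWord {t s : ℕ} (f : (Fin s → Fin t) → ℤ) :
    ∑ v : Fin s → Fin t, ∑ x, f (shiftWord v x) = t * ∑ w, f w := by
  have h1 : ∑ v : Fin s → Fin t, ∑ x, f (shiftWord v x)
      = ∑ w : Fin (s + 1) → Fin t, f (Fin.tail w) := by
    rw [Finset.sum_comm, ← Fintype.sum_prod_type', ← (Fin.snocEquiv fun _ => Fin t).sum_comp]
    rfl
  rw [h1, ← (Fin.consEquiv fun _ => Fin t).sum_comp, Fintype.sum_prod_type]
  simp [Fin.consEquiv]

/-- The matrix of the de Bruijn graph on words of length `s`, minus in each row the row of the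
zero word. -/
def deBruijnDifference (t s : ℕ) [NeZero t] : Matrix (Fin s → Fin t) (Fin s → Fin t) ℤ :=
  fun v w => ∑ x, (if shiftWord v x = w then 1 else 0) - ∑ x, if shiftWord 0 x = w then 1 else 0

theorem deBruijnDifference_mulVec (t s : ℕ) [NeZero t] (f : (Fin s → Fin t) → ℤ)
    (v : Fin s → Fin t) :
    (deBruijnDifference t s *ᵥ f) v = ∑ x, f (shiftWord v x) - ∑ x, f (shiftWord 0 x) := by
  have h : ∀ u : Fin s → Fin t,
      ∑ w, (∑ x, if shiftWord u x = w then (1 : ℤ) else 0) * f w = ∑ x, f (shiftWord u x) := by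
    intro u
    simp only [Finset.sum_mul]
    rw [Finset.sum_comm]
    simp
  simp only [Matrix.mulVec, dotProduct, deBruijnDifference, sub_mul, Finset.sum_sub_distrib, h]

theorem deBruijnDifference_pow_mulVec (t s : ℕ) [NeZero t] (f : (Fin s → Fin t) → ℤ) (j : ℕ) :
    ∀ v w : Fin s → Fin t, (∀ k : Fin s, j ≤ k → v k = w k) →
      (deBruijnDifference t s ^ j *ᵥ f) v = (deBruijnDifference t s ^ j *ᵥ f) w := by
  induction j with
  | zero =>
    intro v w h
    rw [funext fun k => h k (Nat.zero_le _)]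
  | succ j ih =>
    intro v w h
    rw [pow_succ', ← Matrix.mulVec_mulVec, deBruijnDifference_mulVec, deBruijnDifference_mulVec]
    congr 1
    refine Finset.sum_congr rfl fun x _ => ih _ _ fun k hk => ?_
    rw [shiftWord_apply, shiftWord_apply]
    split_ifs with hs
    · exact h _ (by simpa using hk)
    · rfl

/-- Each application forgets one more leading letter: the s-th power sends every vector to a
constant one, and the difference of rows kills constants. -/
theorem deBruijnDifference_isNilpotent (t s : ℕ) [NeZero t] :
    IsNilpotent (deBruijnDifference t s) := by
  refine ⟨s + 1, ?_⟩
  apply Matrix.ext_of_mulVec_single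
  intro i
  funext v
  rw [pow_succ', ← Matrix.mulVec_mulVec, deBruijnDifference_mulVec]
  rw [Matrix.zero_mulVec, Pi.zero_apply, sub_eq_zero]
  exact Finset.sum_congr rfl fun x _ =>
    deBruijnDifference_pow_mulVec t s _ s _ _ fun k hk => absurd k.2 (by omega)

/-- All words lead to the zero word when the letter `g u` is appended to each word `u` in turn, and
the zero word leads to itself. -/
def LeadsToZero {t s : ℕ} [NeZero t] (g : (Fin s → Fin t) → Fin t) : Prop :=
  g 0 = 0 ∧ ∀ u, ∃ k, (fun v => shiftWord v (g v))^[k] u = 0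

/-- The Laplacian of the de Bruijn graph, with the row of the zero word replaced by a unit row. -/
def reducedLaplacian (t s : ℕ) [NeZero t] : Matrix (Fin s → Fin t) (Fin s → Fin t) ℤ :=
  fun v => ∑ x ∈ (if v = 0 then {0} else Finset.univ : Finset (Fin t)),
    fun w => (1 : Matrix _ _ ℤ) v w - if v = 0 then 0 else if shiftWord v x = w then 1 else 0

-- Expand every row as a sum over letters. A choice of one letter per row, with 0 forced in the row
-- of the zero word, is a map `g`, and its term is 1 or 0 according to whether `g` is a tree
-- directed to zero.
open Classical in
theorem det_reducedLaplacian (t s : ℕ) [NeZero t] :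
    (reducedLaplacian t s).det =
      Fintype.card {g : (Fin s → Fin t) → Fin t // LeadsToZero g} := by
  have h1 := (Matrix.detRowAlternating (n := Fin s → Fin t) (R := ℤ)).toMultilinearMap.map_sum_finset
    (fun v x => fun w => (1 : Matrix _ _ ℤ) v w -
      if v = 0 then 0 else if shiftWord v x = w then 1 else 0)
    (fun v => (if v = 0 then {0} else Finset.univ : Finset (Fin t)))
  change (reducedLaplacian t s).det = _ at h1
  rw [h1]
  have h2 : ∀ g ∈ Fintype.piFinset
      (fun v : Fin s → Fin t => (if v = 0 then {0} else Finset.univ : Finset (Fin t))),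
      (Matrix.detRowAlternating (n := Fin s → Fin t) (R := ℤ)).toMultilinearMap
        (fun v => fun w => (1 : Matrix _ _ ℤ) v w -
          if v = 0 then 0 else if shiftWord v (g v) = w then 1 else 0) =
      if LeadsToZero g then 1 else 0 := by
    intro g hg
    have hg0 : g 0 = 0 := by
      have := Fintype.mem_piFinset.mp hg 0
      simpa using this
    have h3 := det_one_sub_functionalMatrix (fun v => shiftWord v (g v)) 0
    have h4 : LeadsToZero g ↔ ∀ u, ∃ k, (fun v => shiftWord v (g v))^[k] u = 0 :=
      ⟨fun h => h.2, fun h => ⟨hg0, h⟩⟩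
    simp only [h4]
    exact h3
  rw [Finset.sum_congr rfl h2, Finset.sum_boole, Fintype.card_subtype]
  congr 2
  ext g
  simp only [Finset.mem_filter, Fintype.mem_piFinset, Finset.mem_univ, true_and, and_iff_right_iff_imp]
  intro h v
  split_ifs with hv
  · rw [hv, h.1]; simp
  · simp

theorem reducedLaplacian_apply (t s : ℕ) [NeZero t] (v w : Fin s → Fin t) :
    reducedLaplacian t s v w = if v = 0 then (1 : Matrix _ _ ℤ) v w else
      t * (1 : Matrix _ _ ℤ) v w - ∑ x, if shiftWord v x = w then 1 else 0 := by
  rw [reducedLaplacian, Finset.sum_apply]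
  split_ifs with hv
  · simp
  · simp [Finset.sum_sub_distrib]

/-- The rows of the full Laplacian sum to zero, in-degrees being t. So once the row of the zero word
is replaced by t times a unit row, the rows sum to the adjacency row of the zero word. The first
factor adds this sum to every other row. -/
theorem smul_one_sub_deBruijnDifference (t s : ℕ) [NeZero t] :
    (t : ℤ) • 1 - deBruijnDifference t s =
      (1 + replicateCol Unit (fun v : Fin s → Fin t => if v = 0 then (0 : ℤ) else 1) *
        replicateRow Unit (fun _ => (1 : ℤ))) *
        (Matrix.diagonal (fun v => if v = 0 then (t : ℤ) else 1) * reducedLaplacian t s) := by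
  set E := Matrix.diagonal (fun v => if v = 0 then (t : ℤ) else 1) * reducedLaplacian t s with hE
  have hE' : ∀ v w, E v w = t * (1 : Matrix _ _ ℤ) v w -
      (if v = 0 then 0 else ∑ x, if shiftWord v x = w then 1 else 0) := by
    intro v w
    rw [hE, Matrix.diagonal_mul, reducedLaplacian_apply]
    split_ifs <;> simp
  have hsum : ∀ w, ∑ u, E u w = ∑ x, if shiftWord (0 : Fin s → Fin t) x = w then (1 : ℤ) else 0 := by
    intro w
    have h1 := sum_shiftWord (fun u : Fin s → Fin t => if u = w then (1 : ℤ) else 0)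
    have h2 : ∀ u, E u w = t * (1 : Matrix _ _ ℤ) u w -
        (∑ x, if shiftWord u x = w then 1 else 0) +
        (if u = 0 then ∑ x, if shiftWord u x = w then 1 else 0 else 0) := by
      intro u
      rw [hE']
      split_ifs <;> ring
    simp only [h2, Finset.sum_add_distrib, Finset.sum_sub_distrib, h1]
    simp [Matrix.one_apply]
  ext v w
  rw [add_mul, one_mul, Matrix.add_apply, Matrix.mul_assoc]
  have h3 : (replicateCol Unit (fun v : Fin s → Fin t => if v = 0 then (0 : ℤ) else 1) *
        (replicateRow Unit (fun _ : Fin s → Fin t => (1 : ℤ)) * E :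
          Matrix Unit (Fin s → Fin t) ℤ) : Matrix (Fin s → Fin t) (Fin s → Fin t) ℤ) v w =
      (if v = 0 then 0 else 1) * ∑ u, E u w := by
    simp [Matrix.mul_apply]
  rw [h3, hsum, hE', Matrix.sub_apply, Matrix.smul_apply, deBruijnDifference]
  by_cases hv : v = 0
  · simp [hv]
  · simp [hv]; ring

-- The rank-one update has determinant 1 + (t^s - 1) = t^s and the diagonal factor contributes one
-- more t.
open Classical in
theorem card_leadsToZero_mul (t s : ℕ) [NeZero t] :
    t ^ (s + 1) * Fintype.card {g : (Fin s → Fin t) → Fin t // LeadsToZero g} = t ^ (t ^ s) := by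
  have h1 := congrArg Matrix.det (smul_one_sub_deBruijnDifference t s)
  rw [Matrix.det_smul_one_sub_of_isNilpotent (deBruijnDifference_isNilpotent t s),
    Matrix.det_mul, Matrix.det_mul, Matrix.det_one_add_replicateCol_mul_replicateRow,
    Matrix.det_diagonal, det_reducedLaplacian] at h1
  have h2 : (fun _ => (1 : ℤ)) ⬝ᵥ (fun v : Fin s → Fin t => if v = 0 then 0 else 1) =
      (t : ℤ) ^ s - 1 := by
    have : ∀ v : Fin s → Fin t, (1 : ℤ) * (if v = 0 then 0 else 1) = 1 - if v = 0 then 1 else 0 := by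
      intro v; split_ifs <;> simp
    simp only [dotProduct, this, Finset.sum_sub_distrib]
    simp
  have h3 : ∏ v : Fin s → Fin t, (if v = 0 then (t : ℤ) else 1) = t := by simp
  rw [h2, h3] at h1
  simp only [Fintype.card_fun, Fintype.card_fin] at h1
  have h4 : ((t ^ (s + 1) * Fintype.card {g : (Fin s → Fin t) → Fin t // LeadsToZero g} : ℕ) : ℤ)
      = ((t ^ (t ^ s) : ℕ) : ℤ) := by
    push_cast
    rw [h1]
    ring
  exact_mod_cast h4

open Classical in
theorem card_leadsToZero (t s : ℕ) [NeZero t] (ht : 2 ≤ t) :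
    Fintype.card {g : (Fin s → Fin t) → Fin t // LeadsToZero g} = t ^ (t ^ s - s - 1) := by
  have h1 := card_leadsToZero_mul t s
  have h2 : s + 1 ≤ t ^ s := Nat.lt_pow_self ht
  have h3 : t ^ (t ^ s) = t ^ (s + 1) * t ^ (t ^ s - s - 1) := by
    rw [← pow_add]; congr 1; omega
  rw [h3] at h1
  exact Nat.eq_of_mul_eq_mul_left (by positivity) h1

/-! ### Preference functions with given least preferred letters -/

/-- The last, least preferred, digit. -/
def leastPreferred {t s : ℕ} [NeZero t] (P : PreferenceFunction t s) (u : Fin s → Fin t) : Fin t :=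
  P u (Fin.rev 0)

open Classical in
theorem Equiv.Perm.card_apply_eq {t : ℕ} (a x : Fin t) :
    Fintype.card {σ : Equiv.Perm (Fin t) // σ a = x} = (t - 1).factorial := by
  have h1 : ∀ y, Fintype.card {σ : Equiv.Perm (Fin t) // σ a = y} =
      Fintype.card {σ : Equiv.Perm (Fin t) // σ a = x} := by
    intro y
    refine Fintype.card_congr ((Equiv.mulLeft (Equiv.swap y x)).subtypeEquiv fun σ => ?_)
    simp only [Equiv.coe_mulLeft, Equiv.Perm.mul_apply]
    rw [Equiv.swap_apply_eq_iff, Equiv.swap_apply_right]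
  have h2 := Fintype.card_congr (Equiv.sigmaFiberEquiv fun σ : Equiv.Perm (Fin t) => σ a)
  rw [Fintype.card_sigma, Finset.sum_congr rfl fun y _ => h1 y] at h2
  simp only [Finset.sum_const, Finset.card_univ, Fintype.card_fin, Fintype.card_perm,
    smul_eq_mul] at h2
  have ht : 0 < t := a.pos
  rw [← Nat.mul_factorial_pred ht.ne'] at h2
  exact Nat.eq_of_mul_eq_mul_left ht h2

open Classical in
theorem card_leadsToZero_leastPreferred (t s : ℕ) [NeZero t] (ht : 2 ≤ t) :
    Fintype.card {P : PreferenceFunction t s // LeadsToZero (leastPreferred P)} =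
      (t - 1).factorial ^ (t ^ s) * t ^ (t ^ s - s - 1) := by
  rw [← card_leadsToZero t s ht]
  have e := Equiv.sigmaFiberEquiv
    (fun P : {P : PreferenceFunction t s // LeadsToZero (leastPreferred P)} =>
      (⟨leastPreferred P.1, P.2⟩ : {g : (Fin s → Fin t) → Fin t // LeadsToZero g}))
  rw [← Fintype.card_congr e, Fintype.card_sigma]
  have h : ∀ g : {g : (Fin s → Fin t) → Fin t // LeadsToZero g},
      Fintype.card {P : {P : PreferenceFunction t s // LeadsToZero (leastPreferred P)} //
        (⟨leastPreferred P.1, P.2⟩ : {g : (Fin s → Fin t) → Fin t // LeadsToZero g}) = g} =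
      (t - 1).factorial ^ (t ^ s) := by
    intro g
    have e' : {P : {P : PreferenceFunction t s // LeadsToZero (leastPreferred P)} //
        (⟨leastPreferred P.1, P.2⟩ : {g : (Fin s → Fin t) → Fin t // LeadsToZero g}) = g} ≃
        ((u : Fin s → Fin t) → {σ : Equiv.Perm (Fin t) // σ (Fin.rev 0) = g.1 u}) :=
      { toFun := fun P u => ⟨P.1.1 u, congrFun (congrArg Subtype.val P.2) u⟩
        invFun := fun Q => ⟨⟨fun u => (Q u).1, by
          have : leastPreferred (fun u => (Q u).1) = g.1 := funext fun u => (Q u).2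
          rw [this]; exact g.2⟩, Subtype.ext (funext fun u => (Q u).2)⟩
        left_inv := fun P => rfl
        right_inv := fun Q => rfl }
    rw [Fintype.card_congr e', Fintype.card_pi]
    simp [Equiv.Perm.card_apply_eq]
  rw [Finset.sum_congr rfl fun g _ => h g]
  simp [mul_comm]

/-! ### From lists to infinite sequences -/

/-- The word of length `m` at position `k` of an infinite sequence. -/
def window {t : ℕ} (m : ℕ) (a : ℕ → Fin t) (k : ℕ) : Fin m → Fin t := fun j => a (k + j)

/-- The letter `x` has not followed the current word of length `m` at any position before `q`. -/
def Fresh {t : ℕ} (m : ℕ) (a : ℕ → Fin t) (q : ℕ) (x : Fin t) : Prop :=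
  ∀ k < q, window m a k = window m a q → a (k + m) ≠ x

/-- The sequence `a` obeys the preference function `P` in order `m + 1` up to its word number `K`. -/
structure Follows {t s : ℕ} [NeZero t] (m : ℕ) (P : PreferenceFunction t s) (a : ℕ → Fin t)
    (K : ℕ) : Prop where
  pos : 0 < K
  initial : ∀ k ≤ m, a k = 0
  next : ∀ q, 0 < q → q < K → ∃ i, a (q + m) = P (window s a (q + (m - s))) i ∧
    Fresh m a q (P (window s a (q + (m - s))) i) ∧
    ∀ j < i, ¬ Fresh m a q (P (window s a (q + (m - s))) j)

/-- Among the first `K` words of length `m + 1` of `a` every word occurs exactly once. -/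
def VisitsOnce {t : ℕ} (m : ℕ) (a : ℕ → Fin t) (K : ℕ) : Prop :=
  ∀ v x, ∃! k, k < K ∧ window m a k = v ∧ a (k + m) = x

/-- The infinite sequence that extends a list by zeros. -/
def extend {t : ℕ} [NeZero t] (S : List (Fin t)) : ℕ → Fin t := fun k => S.getD k 0

theorem take_drop_eq_window {t : ℕ} [NeZero t] (m k : ℕ) (S : List (Fin t))
    (h : k + (m + 1) ≤ S.length) :
    (S.drop k).take (m + 1) = List.ofFn (window m (extend S) k) ++ [extend S (k + m)] := by
  apply List.ext_getElem
  · simp; omega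
  · intro i h1 h2
    simp only [List.length_append, List.length_ofFn, List.length_singleton] at h2
    rw [List.getElem_append]
    split_ifs with hi
    · simp only [List.length_ofFn] at hi
      simp only [List.getElem_take, List.getElem_drop, List.getElem_ofFn, window, extend]
      rw [List.getD_eq_getElem]
    · simp only [List.length_ofFn] at hi
      obtain rfl : i = m := by omega
      simp only [List.getElem_take, List.getElem_drop, List.getElem_singleton, extend]
      rw [List.getD_eq_getElem]

theorem ofFn_append_singleton_inj {t m : ℕ} {v w : Fin m → Fin t} {x y : Fin t} :
    List.ofFn v ++ [x] = List.ofFn w ++ [y] ↔ v = w ∧ x = y := by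
  constructor
  · intro h
    have := List.append_inj h (by simp)
    exact ⟨List.ofFn_injective this.1, by simpa using this.2⟩
  · rintro ⟨rfl, rfl⟩; rfl

theorem exists_ofFn_append_singleton {t m : ℕ} (w : List (Fin t)) (h : w.length = m + 1) :
    ∃ (v : Fin m → Fin t) (x : Fin t), w = List.ofFn v ++ [x] := by
  refine ⟨fun i => w[(i : ℕ)], w[m], ?_⟩
  apply List.ext_getElem
  · simp [h]
  · intro i h1 h2
    rw [List.getElem_append]
    split_ifs with hi
    · simp
    · simp only [List.length_ofFn] at hi
      obtain rfl : i = m := by omega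
      simp

/-- With n = m + 1, the words of length n in `S` start exactly at the positions below `S.length -
m`. -/
theorem isDeBruijn_iff {t : ℕ} [NeZero t] (m : ℕ) (S : List (Fin t)) :
    IsDeBruijn (m + 1) S ↔ VisitsOnce m (extend S) (S.length - m) := by
  have key : ∀ v x k, (k + (m + 1) ≤ S.length ∧
      (S.drop k).take (m + 1) = List.ofFn v ++ [x]) ↔
      (k < S.length - m ∧ window m (extend S) k = v ∧ extend S (k + m) = x) := by
    intro v x k
    have : k + (m + 1) ≤ S.length ↔ k < S.length - m := by omega
    rw [this]
    refine and_congr_right fun hk => ?_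
    rw [take_drop_eq_window m k S (by omega), ofFn_append_singleton_inj]
  constructor
  · intro h v x
    have := h (List.ofFn v ++ [x]) (by simp)
    simpa only [key] using this
  · intro h w hw
    obtain ⟨v, x, rfl⟩ := exists_ofFn_append_singleton w hw
    simpa only [key] using h v x

theorem infix_iff_take_drop {α : Type*} (w L : List α) :
    w <:+: L ↔ ∃ k, k + w.length ≤ L.length ∧ (L.drop k).take w.length = w := by
  constructor
  · rintro ⟨u, v, rfl⟩
    exact ⟨u.length, by simp, by simp⟩
  · rintro ⟨k, _, h⟩
    rw [← h]
    exact (List.take_prefix _ _).isInfix.trans (List.drop_suffix _ _).isInfix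

theorem rtake_eq_window {t : ℕ} [NeZero t] (m : ℕ) (L : List (Fin t)) (h : m ≤ L.length) :
    L.rtake m = List.ofFn (window m (extend L) (L.length - m)) := by
  apply List.ext_getElem
  · simp [List.rtake]; omega
  · intro i h1 h2
    simp only [List.length_ofFn] at h2
    simp only [List.rtake, List.getElem_drop, List.getElem_ofFn, window, extend]
    rw [List.getD_eq_getElem]

theorem isNew_iff {t : ℕ} [NeZero t] (m : ℕ) (L : List (Fin t)) (h : m ≤ L.length) (x : Fin t) :
    IsNew (m + 1) L x ↔ Fresh m (extend L) (L.length - m) x := by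
  rw [IsNew, infix_iff_take_drop, Nat.add_sub_cancel, rtake_eq_window m L h]
  simp only [List.length_append, List.length_ofFn, List.length_singleton, Fresh]
  push Not
  refine forall_congr' fun k => ?_
  constructor
  · intro h1 hk hw hx
    exact h1 (by omega) (by
      rw [take_drop_eq_window m k L (by omega), ofFn_append_singleton_inj]
      exact ⟨hw, hx⟩)
  · intro h1 hk hw
    rw [take_drop_eq_window m k L hk, ofFn_append_singleton_inj] at hw
    exact h1 (by omega) hw.1 hw.2

theorem lastWord_eq_window {t : ℕ} [NeZero t] {s m : ℕ} (hs : s ≤ m) (L : List (Fin t))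
    (h : m ≤ L.length) :
    lastWord s L = window s (extend L) ((L.length - m) + (m - s)) := by
  have : L.length - m + (m - s) = L.length - s := by omega
  rw [this]
  rfl

theorem window_congr {t m k : ℕ} {a b : ℕ → Fin t} (h : ∀ j < k + m, a j = b j) :
    window m a k = window m b k := funext fun j => h _ (by omega)

theorem fresh_congr {t m q : ℕ} {a b : ℕ → Fin t} (h : ∀ j < q + m, a j = b j) (x : Fin t) :
    Fresh m a q x ↔ Fresh m b q x := by
  refine forall₂_congr fun k hk => ?_
  rw [window_congr (m := m) (k := k) fun j hj => h j (by omega), window_congr h,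
    h (k + m) (by omega)]

theorem extend_append {t : ℕ} [NeZero t] (L M : List (Fin t)) {j : ℕ} (hj : j < L.length) :
    extend (L ++ M) j = extend L j := by
  simp only [extend]
  rw [List.getD_append _ _ _ _ hj]

theorem replicate_prefix_iff {t : ℕ} [NeZero t] (n : ℕ) (S : List (Fin t)) :
    List.replicate n 0 <+: S ↔ n ≤ S.length ∧ ∀ k < n, extend S k = 0 := by
  constructor
  · rintro ⟨T, rfl⟩
    refine ⟨by simp, fun k hk => ?_⟩
    rw [extend_append _ _ (by simpa using hk)]
    simp [extend]
  · rintro ⟨h1, h2⟩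
    refine ⟨S.drop n, ?_⟩
    conv_rhs => rw [← List.take_append_drop n S]
    congr 1
    apply List.ext_getElem
    · simp [h1]
    · intro i h3 h4
      simp only [List.length_replicate] at h3
      have := h2 i h3
      rw [extend, List.getD_eq_getElem _ _ (by omega)] at this
      simp [this]

/-- The list `S` is an initial part of the sequence produced by `P`. -/
def IsPartial {t : ℕ} [NeZero t] (n : ℕ) {s : ℕ} (P : PreferenceFunction t s)
    (S : List (Fin t)) : Prop :=
  List.replicate n (0 : Fin t) <+: S ∧
  ∀ (L : List (Fin t)) (x : Fin t), n ≤ L.length → (L ++ [x]) <+: S →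
    ∃ i : Fin t, x = P (lastWord s L) i ∧ IsNew n L (P (lastWord s L) i) ∧
      ∀ j : Fin t, j < i → ¬ IsNew n L (P (lastWord s L) j)

theorem isPartial_iff {t s m : ℕ} [NeZero t] (hs : s ≤ m) (P : PreferenceFunction t s)
    (S : List (Fin t)) :
    IsPartial (m + 1) P S ↔ m + 1 ≤ S.length ∧ Follows m P (extend S) (S.length - m) := by
  rw [IsPartial, replicate_prefix_iff]
  have key : ∀ (L : List (Fin t)) (x : Fin t) (T : List (Fin t)), m + 1 ≤ L.length →
      L ++ [x] ++ T = S →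
      ((∃ i : Fin t, x = P (lastWord s L) i ∧ IsNew (m + 1) L (P (lastWord s L) i) ∧
        ∀ j : Fin t, j < i → ¬ IsNew (m + 1) L (P (lastWord s L) j)) ↔
      ∃ i, extend S ((L.length - m) + m) =
          P (window s (extend S) ((L.length - m) + (m - s))) i ∧
        Fresh m (extend S) (L.length - m)
          (P (window s (extend S) ((L.length - m) + (m - s))) i) ∧
        ∀ j < i, ¬ Fresh m (extend S) (L.length - m)
          (P (window s (extend S) ((L.length - m) + (m - s))) j)) := by
    rintro L x T hL rfl
    have hag : ∀ j < L.length, extend L j = extend (L ++ [x] ++ T) j := by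
      intro j hj
      rw [List.append_assoc, extend_append _ _ hj]
    have hx : extend (L ++ [x] ++ T) (L.length - m + m) = x := by
      rw [Nat.sub_add_cancel (by omega), extend_append _ _ (by simp)]
      simp [extend]
    have hw : window s (extend (L ++ [x] ++ T)) (L.length - m + (m - s)) = lastWord s L := by
      rw [lastWord_eq_window hs L (by omega)]
      exact (window_congr fun j hj => hag j (by omega)).symm
    rw [hx, hw]
    have hf : ∀ y, IsNew (m + 1) L y ↔ Fresh m (extend (L ++ [x] ++ T)) (L.length - m) y := by
      intro y
      rw [isNew_iff m L (by omega)]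
      exact fresh_congr (fun j hj => hag j (by omega)) y
    simp only [hf]
  constructor
  · rintro ⟨⟨h1, h2⟩, h3⟩
    refine ⟨h1, by omega, fun k hk => h2 k (by omega), fun q hq hqK => ?_⟩
    have hlt : q + m < S.length := by omega
    have e : S.take (q + m) ++ [S[q + m]] ++ S.drop (q + m + 1) = S := by
      rw [List.append_assoc, List.singleton_append, List.getElem_cons_drop,
        List.take_append_drop]
    have hl : (S.take (q + m)).length = q + m := by simp; omega
    have := (key _ _ _ (by omega) e).mp (h3 _ _ (by omega) ⟨_, e⟩)
    rw [hl, Nat.add_sub_cancel] at this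
    exact this
  · rintro ⟨h1, h2⟩
    refine ⟨⟨h1, fun k hk => h2.initial k (by omega)⟩, ?_⟩
    rintro L x hL ⟨T, hT⟩
    have hl : L.length + 1 ≤ S.length := by rw [← hT]; simp
    exact (key L x T hL hT).mpr (h2.next _ (by omega) (by omega))

theorem isGeneratedBy_iff_isPartial {t n s : ℕ} [NeZero t] (P : PreferenceFunction t s)
    (S : List (Fin t)) :
    IsGeneratedBy n P S ↔ IsPartial n P S ∧ ∀ i : Fin t, ¬ IsNew n S (P (lastWord s S) i) :=
  ⟨fun h => ⟨⟨h.initial, h.next⟩, h.halts⟩, fun h => ⟨h.1.1, h.1.2, h.2⟩⟩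

theorem isGeneratedBy_iff {t s m : ℕ} [NeZero t] (hs : s ≤ m) (P : PreferenceFunction t s)
    (S : List (Fin t)) :
    IsGeneratedBy (m + 1) P S ↔ m + 1 ≤ S.length ∧ Follows m P (extend S) (S.length - m) ∧
      ∀ x, ¬ Fresh m (extend S) (S.length - m) x := by
  rw [isGeneratedBy_iff_isPartial, isPartial_iff hs, and_assoc]
  refine and_congr_right fun hl => and_congr_right fun _ => ?_
  simp only [isNew_iff m S (by omega : m ≤ S.length)]
  exact (P (lastWord s S)).forall_congr_left.trans (by simp)

/-! ### Words, shifts and suffixes -/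

theorem shiftWord_window {t : ℕ} (m : ℕ) (a : ℕ → Fin t) (k : ℕ) :
    shiftWord (window m a k) (a (k + m)) = window m a (k + 1) := by
  funext j
  rw [shiftWord_apply]
  split_ifs with h
  · simp only [window]
    congr 1
    omega
  · simp only [window]
    congr 1
    omega

/-- The last `s` letters of a word of length `m`, for `s ≤ m`. -/
def suffix {t s m : ℕ} (hs : s ≤ m) (v : Fin m → Fin t) : Fin s → Fin t :=
  fun k => v ⟨k + (m - s), by omega⟩

theorem suffix_window {t s m : ℕ} (hs : s ≤ m) (a : ℕ → Fin t) (q : ℕ) :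
    suffix hs (window m a q) = window s a (q + (m - s)) := by
  funext j
  simp only [suffix, window]
  congr 1
  omega

theorem suffix_self {t m : ℕ} (v : Fin m → Fin t) : suffix le_rfl v = v := by
  funext j
  simp [suffix]

theorem suffix_shiftWord {t s m : ℕ} (hs : s ≤ m) (v : Fin m → Fin t) (x : Fin t) :
    suffix hs (shiftWord v x) = shiftWord (suffix hs v) x := by
  funext j
  simp only [suffix, shiftWord_apply]
  have : (j : ℕ) + (m - s) + 1 < m ↔ (j : ℕ) + 1 < s := by omega
  simp only [this]
  split_ifs
  · congr 1
    ext
    simp only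
    omega
  · rfl

/-- The word of length `m` obtained by writing zeros in front of a word of length `s ≤ m`. -/
def padZero {t s : ℕ} [NeZero t] (m : ℕ) (u : Fin s → Fin t) : Fin m → Fin t :=
  fun j => if h : (j : ℕ) - (m - s) < s ∧ m - s ≤ j then u ⟨j - (m - s), h.1⟩ else 0

theorem suffix_padZero {t s m : ℕ} [NeZero t] (hs : s ≤ m) (u : Fin s → Fin t) :
    suffix hs (padZero m u) = u := by
  funext j
  simp only [suffix, padZero, Nat.add_sub_cancel]
  rw [dif_pos ⟨j.2, by omega⟩]

theorem window_zero {t m : ℕ} [NeZero t] {a : ℕ → Fin t} (h : ∀ k ≤ m, a k = 0) :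
    window m a 0 = 0 := funext fun j => h _ (by omega)

/-! ### Sufficiency: a tree of least preferred letters yields a de Bruijn sequence -/

namespace Follows

variable {t s m K : ℕ} [NeZero t] {P : PreferenceFunction t s} {a : ℕ → Fin t}

theorem injective (hP : Follows m P a K) {k l : ℕ} (hk : k < K) (hl : l < K)
    (hw : window m a k = window m a l) (hx : a (k + m) = a (l + m)) : k = l := by
  rcases lt_trichotomy k l with h | h | h
  · obtain ⟨i, hi, hf, -⟩ := hP.next l (by omega) hl
    exact absurd (hx.trans hi) (hf k h hw)
  · exact h
  · obtain ⟨i, hi, hf, -⟩ := hP.next k (by omega) hk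
    exact absurd (hx.symm.trans hi) (hf l h hw.symm)

theorem exists_earlier (hs : s ≤ m) (hP : Follows m P a K) {l : ℕ} (hl0 : 0 < l) (hl : l < K)
    {i j : Fin t} (hi : a (l + m) = P (suffix hs (window m a l)) i) (hj : j < i) :
    ∃ k < l, window m a k = window m a l ∧ a (k + m) = P (suffix hs (window m a l)) j := by
  obtain ⟨i', hi', -, hf⟩ := hP.next l hl0 hl
  rw [suffix_window] at hi
  obtain rfl : i' = i := (P _).injective (hi'.symm.trans hi)
  have := hf j hj
  rw [Fresh] at this
  push Not at this
  rw [suffix_window]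
  exact this

/-- No edge is used twice, so a sum over positions is a sum over used edges; `I` is the set of
these. -/
theorem sum_add_sum_compl (hP : Follows m P a K) (F : (Fin m → Fin t) × Fin t → ℤ) :
    ∃ I : Finset ((Fin m → Fin t) × Fin t),
      (∀ p, p ∈ I ↔ ∃ k < K, window m a k = p.1 ∧ a (k + m) = p.2) ∧
      ∑ k ∈ range K, F (window m a k, a (k + m)) + ∑ p ∈ Iᶜ, F p = ∑ v, ∑ x, F (v, x) := by
  refine ⟨(range K).image fun k => (window m a k, a (k + m)), fun p => ?_, ?_⟩
  · simp [Prod.ext_iff]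
  · rw [← Fintype.sum_prod_type,
      ← Finset.sum_add_sum_compl ((range K).image fun k => (window m a k, a (k + m))),
      Finset.sum_image]
    intro k hk l hl h
    simp only [Finset.coe_range, Set.mem_Iio] at hk hl
    exact hP.injective hk hl (congrArg Prod.fst h) (congrArg Prod.snd h)

theorem le_card (hP : Follows m P a K) : K ≤ t ^ m * t := by
  obtain ⟨I, -, h⟩ := hP.sum_add_sum_compl fun _ => 1
  have h1 : (K : ℤ) ≤ (t : ℤ) ^ m * t := by
    calc (K : ℤ) ≤ _ := by simp
      _ = _ := h
      _ = _ := by simp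
  exact_mod_cast h1

theorem sum_window (hP : Follows m P a K) {v : Fin m → Fin t}
    (hv : ∀ x, ∃ k < K, window m a k = v ∧ a (k + m) = x) :
    ∑ k ∈ range K, (if window m a k = v then (1 : ℤ) else 0) = t := by
  obtain ⟨I, hI, h⟩ := hP.sum_add_sum_compl fun p => if p.1 = v then 1 else 0
  have h0 : ∑ p ∈ Iᶜ, (if p.1 = v then (1 : ℤ) else 0) = 0 := by
    refine Finset.sum_eq_zero fun p hp => if_neg fun hpv => ?_
    rw [Finset.mem_compl, hI, hpv] at hp
    exact hp (hv p.2)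
  rw [h0, add_zero] at h
  rw [h, Finset.sum_comm]
  simp

theorem sum_window_succ (hP : Follows m P a K) (v : Fin m → Fin t) :
    ∃ I : Finset ((Fin m → Fin t) × Fin t),
      (∀ p, p ∈ I ↔ ∃ k < K, window m a k = p.1 ∧ a (k + m) = p.2) ∧
      ∑ k ∈ range K, (if window m a k = v then (1 : ℤ) else 0) +
        (if window m a K = v then 1 else 0) - (if window m a 0 = v then 1 else 0) +
        ∑ p ∈ Iᶜ, (if shiftWord p.1 p.2 = v then (1 : ℤ) else 0) = t := by
  obtain ⟨I, hI, h⟩ := hP.sum_add_sum_compl fun p => if shiftWord p.1 p.2 = v then 1 else 0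
  refine ⟨I, hI, ?_⟩
  simp only [shiftWord_window] at h
  rw [sum_shiftWord (fun w => if w = v then (1 : ℤ) else 0)] at h
  have h1 := Finset.sum_range_succ (fun k => if window m a k = v then (1 : ℤ) else 0) K
  rw [Finset.sum_range_succ'] at h1
  simp only [Finset.sum_ite_eq', Finset.mem_univ, if_true, mul_one] at h
  linarith

/-- A nonzero final word with all t exits used would have been entered t + 1 times, once more than
it has entering edges. -/
theorem window_eq_zero_of_halts (hP : Follows m P a K)
    (hv : ∀ x, ∃ k < K, window m a k = window m a K ∧ a (k + m) = x) : window m a K = 0 := by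
  by_contra hne
  obtain ⟨I, -, h⟩ := hP.sum_window_succ (window m a K)
  rw [hP.sum_window hv, if_pos rfl, window_zero hP.initial, if_neg (Ne.symm hne)] at h
  have h0 : (0 : ℤ) ≤ ∑ p ∈ Iᶜ, (if shiftWord p.1 p.2 = window m a K then 1 else 0) :=
    Finset.sum_nonneg fun _ _ => by split_ifs <;> norm_num
  linarith

/-- The walk is closed, so a word left t times is entered t times, which uses up all its entering
edges. -/
theorem exists_of_shiftWord (hP : Follows m P a K) (hK : window m a K = 0)
    {u v : Fin m → Fin t} {x : Fin t}
    (hv : ∀ x, ∃ k < K, window m a k = v ∧ a (k + m) = x) (hu : shiftWord u x = v) :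
    ∃ k < K, window m a k = u ∧ a (k + m) = x := by
  obtain ⟨I, hI, h⟩ := hP.sum_window_succ v
  rw [hP.sum_window hv, window_zero hP.initial, hK] at h
  have h0 : ∑ p ∈ Iᶜ, (if shiftWord p.1 p.2 = v then (1 : ℤ) else 0) = 0 := by linarith
  rw [Finset.sum_eq_zero_iff_of_nonneg fun _ _ => by split_ifs <;> norm_num] at h0
  by_contra hne
  have := h0 (u, x) (by rw [Finset.mem_compl, hI]; exact hne)
  simp [hu] at this

/-- If appending least preferred digits leads from every word to the zero word, then the sequence
that follows the preferences until it has to stop visits every word. -/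
theorem visitsOnce (hs : s ≤ m) (hP : Follows m P a K)
    (hv : ∀ x, ∃ k < K, window m a k = window m a K ∧ a (k + m) = x)
    (hl : ∀ v : Fin m → Fin t, ∃ j,
      (fun v => shiftWord v (leastPreferred P (suffix hs v)))^[j] v = 0) :
    VisitsOnce m a K := by
  have hK := hP.window_eq_zero_of_halts hv
  rw [hK] at hv
  have full : ∀ (j : ℕ) (v : Fin m → Fin t),
      (fun v => shiftWord v (leastPreferred P (suffix hs v)))^[j] v = 0 →
      ∀ x, ∃ k < K, window m a k = v ∧ a (k + m) = x := by
    intro j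
    induction j with
    | zero => rintro v rfl; exact hv
    | succ j ih =>
      intro v hvj x
      -- The zero word is set apart because position 0 was not chosen by preference.
      by_cases hv0 : v = 0
      · rw [hv0]; exact hv x
      obtain ⟨l, hlK, hlv, hlx⟩ := hP.exists_of_shiftWord hK (ih _ hvj) rfl
      have hl0 : 0 < l := by
        rcases Nat.eq_zero_or_pos l with rfl | h
        · exact absurd (hlv.symm.trans (window_zero hP.initial)) hv0
        · exact h
      obtain ⟨i, rfl⟩ := (P (suffix hs v)).surjective x
      -- The least preferred exit was used at `l`, so any preferred letter was used before.
      rcases lt_or_eq_of_le (show i ≤ Fin.rev 0 by rw [← Fin.rev_le_rev]; simp) with hi | rfl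
      · obtain ⟨k, hkl, hkv, hkx⟩ := hP.exists_earlier hs hl0 hlK
          (i := Fin.rev 0) (by rw [hlv, hlx]; rfl) hi
        rw [hlv] at hkv hkx
        exact ⟨k, hkl.trans hlK, hkv, hkx⟩
      · exact ⟨l, hlK, hlv, hlx⟩
  intro v x
  obtain ⟨j, hj⟩ := hl v
  obtain ⟨k, hk, hkv, hkx⟩ := full j v hj x
  exact ⟨k, ⟨hk, hkv, hkx⟩, fun l hl => hP.injective hl.1 hk (hl.2.1.trans hkv.symm)
    (hl.2.2.trans hkx.symm)⟩

end Follows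

theorem suffix_iterate {t s m : ℕ} (hs : s ≤ m) (g : (Fin s → Fin t) → Fin t) (j : ℕ)
    (v : Fin m → Fin t) :
    suffix hs ((fun v => shiftWord v (g (suffix hs v)))^[j] v) =
      (fun u => shiftWord u (g u))^[j] (suffix hs v) := by
  induction j generalizing v with
  | zero => rfl
  | succ j ih => rw [Function.iterate_succ_apply, ih, Function.iterate_succ_apply, suffix_shiftWord]

theorem LeadsToZero.exists_iterate {t s m : ℕ} [NeZero t] (hs : s ≤ m)
    {g : (Fin s → Fin t) → Fin t} (hg : LeadsToZero g) (v : Fin m → Fin t) :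
    ∃ j, (fun v => shiftWord v (g (suffix hs v)))^[j] v = 0 := by
  -- Once the suffix of length s is zero only zeros are appended, and each step flushes one of the
  -- `c` leading letters that may be nonzero.
  have tail : ∀ (c : ℕ) (w : Fin m → Fin t), c ≤ m - s → (∀ k : Fin m, c ≤ k → w k = 0) →
      ∃ j, (fun v => shiftWord v (g (suffix hs v)))^[j] w = 0 := by
    intro c
    induction c with
    | zero => exact fun w _ h => ⟨0, funext fun k => h k (Nat.zero_le _)⟩
    | succ c ih =>
      intro w hc h
      have hw : suffix hs w = 0 := funext fun k => h _ (by simp only; omega)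
      obtain ⟨j, hj⟩ := ih (shiftWord w (g (suffix hs w))) (by omega) (fun k hk => by
        rw [shiftWord_apply, hw, hg.1]
        split_ifs with hk'
        · exact h _ (by simpa using hk)
        · rfl)
      exact ⟨j + 1, hj⟩
  obtain ⟨j, hj⟩ := hg.2 (suffix hs v)
  rw [← suffix_iterate hs] at hj
  obtain ⟨i, hi⟩ := tail (m - s)
    ((fun v => shiftWord v (g (suffix hs v)))^[j] v) le_rfl (fun k hk => by
    have := congrFun hj ⟨k - (m - s), by omega⟩
    have hk' : (⟨k - (m - s) + (m - s), by omega⟩ : Fin m) = k := Fin.ext (by simp only; omega)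
    simpa only [suffix, hk', Pi.zero_apply] using this)
  exact ⟨i + j, by rw [Function.iterate_add_apply]; exact hi⟩

/-! ### Necessity: last exits form a tree directed to zero -/

theorem VisitsOnce.halts {t m K : ℕ} {a : ℕ → Fin t}
    (hv : VisitsOnce m a K) (x : Fin t) : ¬ Fresh m a K x := by
  obtain ⟨k, ⟨hk, hw, hx⟩, -⟩ := hv (window m a K) x
  exact fun h => h k hk hw hx

namespace VisitsOnce

variable {t m K : ℕ} [NeZero t] {a : ℕ → Fin t}

/-- The position of each word, except that the initial zero word is put at the end. -/
theorem exists_key (hv : VisitsOnce m a K) (h0 : ∀ k ≤ m, a k = 0) :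
    ∃ κ : (Fin m → Fin t) → Fin t → ℕ, (∀ v, Function.Injective (κ v)) ∧
      (∀ k, 0 < k → k < K → κ (window m a k) (a (k + m)) = k) ∧ κ 0 0 = K ∧
      ∀ v x, ¬ (v = 0 ∧ x = 0) → 0 < κ v x ∧ κ v x < K ∧ window m a (κ v x) = v ∧
        a (κ v x + m) = x := by
  choose p hp hu using hv
  simp only at hp hu
  have hK : 0 < K := (Nat.zero_le _).trans_lt (hp 0 0).1
  have hp0 : p 0 0 = 0 := (hu 0 0 0 ⟨hK, window_zero h0, by simpa using h0 m le_rfl⟩).symm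
  have hpos : ∀ v x, ¬ (v = 0 ∧ x = 0) → 0 < p v x := by
    intro v x hvx
    rcases Nat.eq_zero_or_pos (p v x) with h | h
    · obtain ⟨-, h1, h2⟩ := hp v x
      rw [h] at h1 h2
      exact absurd ⟨h1.symm.trans (window_zero h0), by
        rw [← h2, Nat.zero_add]; exact h0 m le_rfl⟩ hvx
    · exact h
  -- The edge at position 0 is imposed, not preferred. Giving it the value `K` makes the letter 0
  -- the last one after the zero word.
  refine ⟨fun v x => if v = 0 ∧ x = 0 then K else p v x, ?_, ?_, by simp, ?_⟩
  · intro v x y hxy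
    simp only at hxy
    split_ifs at hxy with h1 h2 h2
    · rw [h1.2, h2.2]
    · exact absurd hxy (hp v y).1.ne'
    · exact absurd hxy (hp v x).1.ne
    · rw [← (hp v x).2.2, ← (hp v y).2.2, hxy]
  · intro k hk hkK
    have h1 := hu _ _ k ⟨hkK, rfl, rfl⟩
    simp only
    rw [if_neg, ← h1]
    rintro ⟨h2, h3⟩
    rw [h2, h3, hp0] at h1
    omega
  · intro v x hvx
    simp only [if_neg hvx]
    exact ⟨hpos v x hvx, hp v x⟩

theorem follows_of_key {s : ℕ} (hs : s ≤ m) (hv : VisitsOnce m a K) (h0 : ∀ k ≤ m, a k = 0)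
    {κ : (Fin m → Fin t) → Fin t → ℕ}
    (h1 : ∀ k, 0 < k → k < K → κ (window m a k) (a (k + m)) = k)
    (h2 : ∀ v x, ¬ (v = 0 ∧ x = 0) → 0 < κ v x ∧ κ v x < K ∧ window m a (κ v x) = v ∧
        a (κ v x + m) = x)
    (P : PreferenceFunction t s)
    (hP : ∀ v, StrictMono (κ v ∘ P (suffix hs v))) : Follows m P a K := by
  have hK : 0 < K := by
    obtain ⟨k, hk, -⟩ := hv 0 0
    exact (Nat.zero_le _).trans_lt hk.1
  refine ⟨hK, h0, fun q hq hqK => ?_⟩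
  rw [← suffix_window hs]
  obtain ⟨i, hi⟩ := (P (suffix hs (window m a q))).surjective (a (q + m))
  refine ⟨i, hi.symm, fun k hk hw hx => ?_, fun j hj hf => ?_⟩
  · have := (hv (window m a q) (a (q + m))).unique ⟨hk.trans hqK, hw, hx.trans hi⟩ ⟨hqK, rfl, rfl⟩
    omega
  · have h3 := hP (window m a q) hj
    simp only [Function.comp_apply, hi] at h3
    rw [h1 q hq hqK] at h3
    by_cases hz : window m a q = 0 ∧ P (suffix hs (window m a q)) j = 0
    · refine hf 0 hq ?_ ?_
      · rw [hz.1, window_zero h0]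
      · rw [hz.2, Nat.zero_add]; exact h0 m le_rfl
    · obtain ⟨-, -, h4, h5⟩ := h2 _ _ hz
      exact hf _ h3 h4 h5

end VisitsOnce

namespace Follows

variable {t s m K : ℕ} [NeZero t] {P : PreferenceFunction t s} {a : ℕ → Fin t}

/-- Preferred letters are used earlier. Only at the zero word can the moved key `K` disturb the
order, which is what `hv` excludes. -/
theorem strictMono_key (hs : s ≤ m) (hP : Follows m P a K)
    {κ : (Fin m → Fin t) → Fin t → ℕ}
    (h0 : κ 0 0 = K)
    (h2 : ∀ v x, ¬ (v = 0 ∧ x = 0) → 0 < κ v x ∧ κ v x < K ∧ window m a (κ v x) = v ∧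
        a (κ v x + m) = x)
    {v : Fin m → Fin t} (hv : v = 0 → leastPreferred P 0 = 0) :
    StrictMono (κ v ∘ P (suffix hs v)) := by
  intro i j hij
  simp only [Function.comp_apply]
  have hi : ¬ (v = 0 ∧ P (suffix hs v) i = 0) := by
    rintro ⟨rfl, h⟩
    have : P (suffix hs 0) (Fin.rev 0) = 0 := hv rfl
    have := (P _).injective (h.trans this.symm)
    rw [this] at hij
    have := Fin.rev_lt_rev.mpr hij
    simp at this
  obtain ⟨hi0, hiK, hi1, hi2⟩ := h2 _ _ hi
  by_cases hj : v = 0 ∧ P (suffix hs v) j = 0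
  · rw [hj.2, hj.1, h0]
    rwa [hj.1] at hiK
  · obtain ⟨hj0, hjK, hj1, hj2⟩ := h2 _ _ hj
    obtain ⟨k, hk, hk1, hk2⟩ := hP.exists_earlier hs hj0 hjK (i := j) (by rw [hj1, hj2]) hij
    rw [hj1] at hk1 hk2
    rw [hP.injective hiK (hk.trans hjK) (hi1.trans hk1.symm) (hi2.trans hk2.symm)]
    exact hk

theorem exists_iterate (hs : s ≤ m) (hP : Follows m P a K) (hv : VisitsOnce m a K)
    (v : Fin m → Fin t) :
    ∃ j, (fun v => shiftWord v (leastPreferred P (suffix hs v)))^[j] v = 0 := by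
  have hK : window m a K = 0 := hP.window_eq_zero_of_halts fun x => by
    obtain ⟨k, hk, -⟩ := hv (window m a K) x
    exact ⟨k, hk⟩
  obtain ⟨κ, hκ1, hκ2, hκ3, hκ4⟩ := hv.exists_key hP.initial
  -- Induction on the time left after the last exit from `v`: the next word, if nonzero, has its own
  -- last exit strictly later.
  have main : ∀ (N : ℕ) (v : Fin m → Fin t), v ≠ 0 →
      K - κ v (leastPreferred P (suffix hs v)) = N →
      ∃ j, (fun v => shiftWord v (leastPreferred P (suffix hs v)))^[j] v = 0 := by
    intro N
    induction N using Nat.strong_induction_on with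
    | _ N ih =>
      intro v hv0 hN
      obtain ⟨h1, h2, h3, h4⟩ := hκ4 v (leastPreferred P (suffix hs v)) (fun h => hv0 h.1)
      set k := κ v (leastPreferred P (suffix hs v))
      have hstep : shiftWord v (leastPreferred P (suffix hs v)) = window m a (k + 1) := by
        rw [← shiftWord_window, h3, h4]
      by_cases hw : window m a (k + 1) = 0
      · exact ⟨1, hstep.trans hw⟩
      · have hk1 : k + 1 < K := by
          rcases Nat.lt_or_ge (k + 1) K with h | h
          · exact h
          · have : k + 1 = K := by omega
            rw [this] at hw
            exact absurd hK hw
        have hmono := hP.strictMono_key hs hκ3 hκ4 (v := window m a (k + 1))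
          (fun h => absurd h hw)
        obtain ⟨i, hi⟩ := (P (suffix hs (window m a (k + 1)))).surjective (a (k + 1 + m))
        have hle := hmono.monotone (show i ≤ Fin.rev 0 by rw [← Fin.rev_le_rev]; simp)
        simp only [Function.comp_apply, hi] at hle
        rw [hκ2 (k + 1) (by omega) hk1] at hle
        change _ ≤ κ _ (leastPreferred P _) at hle
        obtain ⟨j, hj⟩ := ih _ (by omega) (window m a (k + 1)) hw rfl
        exact ⟨j + 1, by rw [Function.iterate_succ_apply, hstep]; exact hj⟩
  by_cases hv0 : v = 0
  · exact ⟨0, hv0⟩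
  · exact main _ v hv0 rfl

theorem leadsToZero (hs : s ≤ m) (hP : Follows m P a K) (hv : VisitsOnce m a K)
    (h0 : leastPreferred P 0 = 0) : LeadsToZero (leastPreferred P) := by
  refine ⟨h0, fun u => ?_⟩
  obtain ⟨j, hj⟩ := hP.exists_iterate hs hv (padZero m u)
  refine ⟨j, ?_⟩
  rw [← suffix_padZero hs u, ← suffix_iterate, hj]
  rfl

/-- Some nonzero word is sent to zero by its least preferred letter. All its letters but the first
are zero, so as s < m its suffix of length s is zero and the appended letter is the one preferred
least after zero. -/
theorem leastPreferred_zero (ht : 2 ≤ t) (hs : s < m) (hP : Follows m P a K)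
    (hv : VisitsOnce m a K) : leastPreferred P 0 = 0 := by
  have h1 : (⟨1, ht⟩ : Fin t) ≠ 0 := by
    intro h
    have := congrArg Fin.val h
    simp at this
  have key : ∀ (j : ℕ) (v : Fin m → Fin t), v ≠ 0 →
      (fun v => shiftWord v (leastPreferred P (suffix hs.le v)))^[j] v = 0 →
      leastPreferred P 0 = 0 := by
    intro j
    induction j with
    | zero => exact fun v hv h => absurd h hv
    | succ j ih =>
      intro v hv0 h
      rw [Function.iterate_succ_apply] at h
      by_cases hw : shiftWord v (leastPreferred P (suffix hs.le v)) = 0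
      · have h2 : suffix hs.le v = 0 := by
          funext k
          have := congrFun hw ⟨k + (m - s) - 1, by omega⟩
          rw [shiftWord_apply, dif_pos (by simp only; omega)] at this
          rw [suffix]
          simp only [Pi.zero_apply] at this ⊢
          rw [← this]
          congr 1
          ext
          simp only
          omega
        have := congrFun hw ⟨m - 1, by omega⟩
        rw [shiftWord_apply, dif_neg (by simp only; omega), h2] at this
        exact this
      · exact ih _ hw h
  obtain ⟨j, hj⟩ := hP.exists_iterate hs.le hv (fun _ => ⟨1, ht⟩)
  exact key j _ (fun h => h1 (congrFun h ⟨0, by omega⟩)) hj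

end Follows

/-! ### Recovering the preference function from the sequence -/

theorem perm_eq_of_strictMono {t : ℕ} {κ : Fin t → ℕ} {σ τ : Equiv.Perm (Fin t)}
    (hσ : StrictMono (κ ∘ σ)) (hτ : StrictMono (κ ∘ τ)) : σ = τ := by
  have h := Tuple.unique_monotone hσ.monotone hτ.monotone
  have hκ : Function.Injective κ := by
    have := hσ.injective.comp σ.symm.injective
    rwa [Function.comp_assoc, Equiv.self_comp_symm, Function.comp_id] at this
  exact Equiv.ext fun i => hκ (congrFun h i)

theorem preferenceFunction_eq_of_follows {t s m K : ℕ} [NeZero t] (hs : s ≤ m)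
    {P Q : PreferenceFunction t s} {a : ℕ → Fin t}
    (hv : VisitsOnce m a K) (hP : Follows m P a K) (hQ : Follows m Q a K)
    (hP0 : leastPreferred P 0 = 0) (hQ0 : leastPreferred Q 0 = 0) : P = Q := by
  obtain ⟨κ, hκ1, hκ2, hκ3, hκ4⟩ := hv.exists_key hP.initial
  funext u
  rw [← suffix_padZero hs u]
  exact perm_eq_of_strictMono (hP.strictMono_key hs hκ3 hκ4 fun _ => hP0)
    (hQ.strictMono_key hs hκ3 hκ4 fun _ => hQ0)

/-- With span m each word may rank its letters by time of use; the key `K` puts 0 last after the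
zero word. -/
theorem VisitsOnce.exists_follows {t m K : ℕ} [NeZero t] {a : ℕ → Fin t}
    (hv : VisitsOnce m a K) (h0 : ∀ k ≤ m, a k = 0) :
    ∃ P : PreferenceFunction t m, Follows m P a K ∧ leastPreferred P 0 = 0 := by
  obtain ⟨κ, hκ1, hκ2, hκ3, hκ4⟩ := hv.exists_key h0
  have hmono : ∀ v, StrictMono (κ v ∘ Tuple.sort (κ v)) := fun v =>
    (Tuple.monotone_sort (κ v)).strictMono_of_injective ((hκ1 v).comp (Equiv.injective _))
  refine ⟨fun v => Tuple.sort (κ v), ?_, ?_⟩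
  · exact hv.follows_of_key le_rfl h0 hκ2 hκ4 _ fun v => by
      rw [suffix_self]; exact hmono v
  · by_contra hne
    obtain ⟨-, h1, -⟩ := hκ4 0 (leastPreferred (fun v => Tuple.sort (κ v)) 0) (fun h => hne h.2)
    obtain ⟨i, hi⟩ := (Tuple.sort (κ 0)).surjective 0
    have hle := (hmono 0).monotone (show i ≤ Fin.rev 0 by rw [← Fin.rev_le_rev]; simp)
    simp only [Function.comp_apply, hi, hκ3] at hle
    exact absurd h1 (not_lt.mpr hle)

/-- Preferences may be taken to depend on one more letter. -/
theorem Follows.tail {t s m K : ℕ} [NeZero t] (hs : s < m) {P : PreferenceFunction t s}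
    {a : ℕ → Fin t} (hP : Follows m P a K) :
    Follows m (fun u : Fin (s + 1) → Fin t => P (Fin.tail u)) a K := by
  refine ⟨hP.pos, hP.initial, fun q hq hqK => ?_⟩
  have : Fin.tail (window (s + 1) a (q + (m - (s + 1)))) = window s a (q + (m - s)) := by
    funext j
    simp only [Fin.tail, window, Fin.val_succ]
    congr 1
    omega
  simp only [this]
  exact hP.next q hq hqK

/-! ### Existence and uniqueness of the generated sequence -/

theorem IsPartial.exists_longer {t n s : ℕ} [NeZero t] {P : PreferenceFunction t s}
    {S : List (Fin t)} (hS : IsPartial n P S) (hg : ¬ IsGeneratedBy n P S) :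
    ∃ y, IsPartial n P (S ++ [y]) := by
  rw [isGeneratedBy_iff_isPartial] at hg
  push Not at hg
  obtain ⟨i, hi, hmin⟩ := wellFounded_lt.has_min
    {i : Fin t | IsNew n S (P (lastWord s S) i)} (hg hS)
  refine ⟨P (lastWord s S) i, hS.1.trans (List.prefix_append _ _), fun L x hL hpre => ?_⟩
  rcases List.prefix_concat_iff.mp hpre with h | h
  · obtain ⟨rfl, h2⟩ := List.append_inj' h rfl
    exact ⟨i, by simpa using h2, hi, fun j hj hn => hmin j hn hj⟩
  · exact hS.2 L x hL h

/-- Without halting there would be arbitrarily long partial sequences, against the bound on the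
number of distinct words. -/
theorem exists_isGeneratedBy {t s m : ℕ} [NeZero t] (hs : s ≤ m) (P : PreferenceFunction t s) :
    ∃ S, IsGeneratedBy (m + 1) P S := by
  by_contra! hne
  have long : ∀ N : ℕ, ∃ S, IsPartial (m + 1) P S ∧ N ≤ S.length := by
    intro N
    induction N with
    | zero =>
      refine ⟨List.replicate (m + 1) 0, ⟨List.prefix_rfl, fun L x hL h => ?_⟩, Nat.zero_le _⟩
      have := h.length_le
      simp only [List.length_append, List.length_singleton, List.length_replicate] at this
      omega
    | succ N ih =>
      obtain ⟨S, hS, hN⟩ := ih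
      obtain ⟨y, hy⟩ := hS.exists_longer (hne S)
      exact ⟨_, hy, by simpa using hN⟩
  obtain ⟨S, hS, hl⟩ := long (t ^ m * t + m + 1)
  have := ((isPartial_iff hs P S).mp hS).2.le_card
  omega

theorem IsGeneratedBy.prefix {t n s : ℕ} [NeZero t] {P : PreferenceFunction t s}
    {S T : List (Fin t)} (hS : IsGeneratedBy n P S) (hT : IsGeneratedBy n P T) : S <+: T := by
  suffices h : ∀ L, L <+: S → L <+: T from h S List.prefix_rfl
  intro L
  induction L using List.reverseRecOn with
  | nil => exact fun _ => List.nil_prefix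
  | append_singleton L x ih =>
    intro hL
    rcases Nat.lt_or_ge L.length n with hn | hn
    · exact (List.prefix_of_prefix_length_le hL hS.initial (by simpa using hn)).trans hT.initial
    · obtain ⟨i, hxi, hi, hmin⟩ := hS.next L x hn hL
      obtain ⟨M, hM⟩ := ih ((List.prefix_append _ _).trans hL)
      cases M with
      | nil =>
        rw [List.append_nil] at hM
        subst hM
        exact absurd hi (hT.halts i)
      | cons y M =>
        have hy : L ++ [y] <+: T := ⟨M, by rw [List.append_assoc]; exact hM⟩
        obtain ⟨j, hyj, hj, hmin'⟩ := hT.next L y hn hy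
        have hij : i = j := le_antisymm (not_lt.mp fun h => hmin j h hj)
          (not_lt.mp fun h => hmin' i h hi)
        rw [hxi, hij, ← hyj]
        exact hy

theorem IsGeneratedBy.unique {t n s : ℕ} [NeZero t] {P : PreferenceFunction t s}
    {S T : List (Fin t)} (hS : IsGeneratedBy n P S) (hT : IsGeneratedBy n P T) : S = T :=
  (hS.prefix hT).eq_of_length_le (hT.prefix hS).length_le

/-! ### Counting by complexity -/

/-- The de Bruijn sequences starting with zeros that some preference function of span `s`
generates. -/
def generatedSet (t n s : ℕ) [NeZero t] : Set (List (Fin t)) :=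
  {S | IsZeroDeBruijn n S ∧ ∃ P : PreferenceFunction t s, IsGeneratedBy n P S}

theorem IsZeroDeBruijn.initial {t m : ℕ} [NeZero t] {S : List (Fin t)}
    (hS : IsZeroDeBruijn (m + 1) S) : ∀ k ≤ m, extend S k = 0 := fun k hk =>
  ((replicate_prefix_iff _ _).mp hS.2).2 k (by omega)

theorem IsZeroDeBruijn.isGeneratedBy_iff {t s m : ℕ} [NeZero t] (hs : s ≤ m)
    {S : List (Fin t)} (hS : IsZeroDeBruijn (m + 1) S) (P : PreferenceFunction t s) :
    IsGeneratedBy (m + 1) P S ↔ Follows m P (extend S) (S.length - m) := by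
  rw [_root_.isGeneratedBy_iff hs]
  exact ⟨fun h => h.2.1, fun h => ⟨((replicate_prefix_iff _ _).mp hS.2).1, h,
    ((isDeBruijn_iff m S).mp hS.1).halts⟩⟩

theorem mem_generatedSet_self {t m : ℕ} [NeZero t] {S : List (Fin t)}
    (hS : IsZeroDeBruijn (m + 1) S) : S ∈ generatedSet t (m + 1) m := by
  obtain ⟨P, hP, -⟩ := ((isDeBruijn_iff m S).mp hS.1).exists_follows hS.initial
  exact ⟨hS, P, (hS.isGeneratedBy_iff le_rfl P).mpr hP⟩

theorem generatedSet_subset_succ {t s m : ℕ} [NeZero t] (hs : s < m) :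
    generatedSet t (m + 1) s ⊆ generatedSet t (m + 1) (s + 1) := by
  rintro S ⟨hS, P, hP⟩
  rw [hS.isGeneratedBy_iff hs.le] at hP
  exact ⟨hS, _, (hS.isGeneratedBy_iff hs _).mpr (hP.tail hs)⟩

theorem generatedSet_mono {t s r m : ℕ} [NeZero t] (hsr : s ≤ r) (hr : r ≤ m) :
    generatedSet t (m + 1) s ⊆ generatedSet t (m + 1) r := by
  induction r, hsr using Nat.le_induction with
  | base => exact subset_rfl
  | succ r _ ih => exact (ih (by omega)).trans (generatedSet_subset_succ (by omega))

/-- For s = m the given `P` may rank 0 above another letter after the zero word, so it is replaced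
by the normalised function. -/
theorem exists_leadsToZero {t s m : ℕ} [NeZero t] (ht : 2 ≤ t) (hs : s ≤ m) {S : List (Fin t)}
    (hS : S ∈ generatedSet t (m + 1) s) :
    ∃ P : PreferenceFunction t s, LeadsToZero (leastPreferred P) ∧ IsGeneratedBy (m + 1) P S := by
  obtain ⟨hZ, P, hP⟩ := hS
  have hv := (isDeBruijn_iff m S).mp hZ.1
  rcases lt_or_eq_of_le hs with h | rfl
  · have hF := (hZ.isGeneratedBy_iff hs P).mp hP
    exact ⟨P, hF.leadsToZero hs hv (hF.leastPreferred_zero ht h hv), hP⟩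
  · obtain ⟨Q, hQ, hQ0⟩ := hv.exists_follows hZ.initial
    exact ⟨Q, hQ.leadsToZero hs hv hQ0, (hZ.isGeneratedBy_iff hs Q).mpr hQ⟩

theorem isZeroDeBruijn_of_leadsToZero {t s m : ℕ} [NeZero t] (hs : s ≤ m) {S : List (Fin t)}
    {P : PreferenceFunction t s} (hP : LeadsToZero (leastPreferred P))
    (hS : IsGeneratedBy (m + 1) P S) : IsZeroDeBruijn (m + 1) S := by
  refine ⟨?_, hS.initial⟩
  obtain ⟨-, hF, hh⟩ := (isGeneratedBy_iff hs P S).mp hS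
  rw [isDeBruijn_iff]
  refine hF.visitsOnce hs (fun x => ?_) (hP.exists_iterate hs)
  have := hh x
  rw [Fresh] at this
  push Not at this
  exact this

theorem ncard_generatedSet {t s m : ℕ} [NeZero t] (ht : 2 ≤ t) (hs : s ≤ m) :
    (generatedSet t (m + 1) s).ncard = (t - 1).factorial ^ (t ^ s) * t ^ (t ^ s - s - 1) := by
  classical
  choose gen hgen using fun P : PreferenceFunction t s => exists_isGeneratedBy (m := m) hs P
  have himage : gen '' {P | LeadsToZero (leastPreferred P)} = generatedSet t (m + 1) s := by
    apply Set.Subset.antisymm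
    · rintro _ ⟨P, hP, rfl⟩
      exact ⟨isZeroDeBruijn_of_leadsToZero hs hP (hgen P), P, hgen P⟩
    · intro S hS
      obtain ⟨P, hP, hPS⟩ := exists_leadsToZero ht hs hS
      exact ⟨P, hP, (hgen P).unique hPS⟩
  have hinj : Set.InjOn gen {P | LeadsToZero (leastPreferred P)} := by
    intro P hP Q hQ hPQ
    have hZ := isZeroDeBruijn_of_leadsToZero hs hP (hgen P)
    have hQ' := hgen Q
    rw [← hPQ] at hQ'
    exact preferenceFunction_eq_of_follows hs ((isDeBruijn_iff m _).mp hZ.1)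
      ((hZ.isGeneratedBy_iff hs P).mp (hgen P)) ((hZ.isGeneratedBy_iff hs Q).mp hQ') hP.1 hQ.1
  rw [← himage, hinj.ncard_image, ← card_leadsToZero_leastPreferred t s ht,
    ← Nat.card_coe_set_eq, Nat.card_eq_fintype_card]
  rfl

theorem finite_generatedSet {t s m : ℕ} [NeZero t] (ht : 2 ≤ t) (hs : s ≤ m) :
    (generatedSet t (m + 1) s).Finite := by
  apply Set.finite_of_ncard_ne_zero
  rw [ncard_generatedSet ht hs]
  positivity

theorem hasPrefComplexity_succ_iff {t s m : ℕ} [NeZero t] (hs : s < m) (S : List (Fin t)) :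
    IsZeroDeBruijn (m + 1) S ∧ HasPrefComplexity (m + 1) S (s + 1) ↔
      S ∈ generatedSet t (m + 1) (s + 1) \ generatedSet t (m + 1) s := by
  constructor
  · rintro ⟨hS, ⟨-, hP⟩, hmin⟩
    refine ⟨⟨hS, hP⟩, fun h => ?_⟩
    have := hmin ⟨by omega, h.2⟩
    omega
  · rintro ⟨⟨hS, hP⟩, hn⟩
    refine ⟨hS, ⟨by omega, hP⟩, fun r hr => ?_⟩
    by_contra hlt
    exact hn (generatedSet_mono (by omega) hs.le ⟨hS, hr.2⟩)

theorem prefComplexityCount_succ {t s m : ℕ} [NeZero t] (ht : 2 ≤ t) (hs : s < m) :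
    (prefComplexityCount t (m + 1) (s + 1) : ℤ) =
      ((t - 1).factorial : ℤ) ^ (t ^ (s + 1)) * (t : ℤ) ^ (t ^ (s + 1) - (s + 1) - 1) -
        ((t - 1).factorial : ℤ) ^ (t ^ s) * (t : ℤ) ^ (t ^ s - s - 1) := by
  have h : {S : List (Fin t) | IsZeroDeBruijn (m + 1) S ∧ HasPrefComplexity (m + 1) S (s + 1)} =
      generatedSet t (m + 1) (s + 1) \ generatedSet t (m + 1) s :=
    Set.ext (hasPrefComplexity_succ_iff hs)
  rw [prefComplexityCount, h]
  have hle := Set.ncard_le_ncard (generatedSet_subset_succ (t := t) hs)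
    (finite_generatedSet ht hs)
  rw [Set.ncard_sdiff (generatedSet_subset_succ hs) (finite_generatedSet ht hs.le),
    Nat.cast_sub hle, ncard_generatedSet ht hs.le, ncard_generatedSet ht hs]
  push_cast
  rfl

theorem prefComplexityCount_zero {t m : ℕ} [NeZero t] (ht : 2 ≤ t) :
    prefComplexityCount t (m + 1) 0 = (t - 1).factorial := by
  have h : {S : List (Fin t) | IsZeroDeBruijn (m + 1) S ∧ HasPrefComplexity (m + 1) S 0} =
      generatedSet t (m + 1) 0 := by
    ext S
    exact ⟨fun h => ⟨h.1, h.2.1.2⟩,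
      fun h => ⟨h.1, ⟨Nat.zero_le _, h.2⟩, fun r _ => Nat.zero_le r⟩⟩
  rw [prefComplexityCount, h, ncard_generatedSet ht (Nat.zero_le m)]
  simp

theorem IsZeroDeBruijn.exists_hasPrefComplexity {t m : ℕ} [NeZero t] {S : List (Fin t)}
    (hS : IsZeroDeBruijn (m + 1) S) : ∃ i < m + 1, HasPrefComplexity (m + 1) S i := by
  classical
  have hm : ∃ s, s ≤ m + 1 ∧ ∃ P : PreferenceFunction t s, IsGeneratedBy (m + 1) P S :=
    ⟨m, by omega, (mem_generatedSet_self hS).2⟩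
  refine ⟨Nat.find hm, ?_, Nat.find_spec hm, fun r hr => Nat.find_min' hm hr⟩
  exact Nat.lt_succ_of_le (Nat.find_min' hm ⟨by omega, (mem_generatedSet_self hS).2⟩)

theorem mainTheorem3 (t : ℕ) [NeZero t] (ht : 2 ≤ t) (n : ℕ) (hn : 1 ≤ n) :
    (∀ S : List (Fin t), IsZeroDeBruijn n S → ∃ i : ℕ, i < n ∧ HasPrefComplexity n S i) ∧
    prefComplexityCount t n 0 = (t - 1).factorial ∧
    (1 < n → (prefComplexityCount t n 1 : ℤ) =
      ((t - 1).factorial : ℤ) ^ t * (t : ℤ) ^ (t - 2) - ((t - 1).factorial : ℤ)) ∧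
    (∀ i : ℕ, 1 < i → i < n → (prefComplexityCount t n i : ℤ) =
      ((t - 1).factorial : ℤ) ^ (t ^ i) * (t : ℤ) ^ (t ^ i - i - 1) -
        ((t - 1).factorial : ℤ) ^ (t ^ (i - 1)) * (t : ℤ) ^ (t ^ (i - 1) - i)) := by
  obtain ⟨m, rfl⟩ : ∃ m, n = m + 1 := ⟨n - 1, by omega⟩
  refine ⟨fun S hS => hS.exists_hasPrefComplexity, prefComplexityCount_zero ht, fun h => ?_,
    fun i hi him => ?_⟩
  · rw [prefComplexityCount_succ ht (s := 0) (by omega)]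
    simp [Nat.sub_sub]
  · obtain ⟨s, rfl⟩ : ∃ s, i = s + 1 := ⟨i - 1, by omega⟩
    rw [prefComplexityCount_succ ht (by omega), Nat.add_sub_cancel, Nat.sub_sub (t ^ s)]
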